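/- Definitions. Let $\Gamma=(V,E)$ be a finite simple graph. Its right-angled Artin group is $A_\Gamma=\langle V\mid [v,w]=1 \text{ if } vw\in E\rangle$, and $N_\Gamma=A_\Gamma/\gamma_3(A_\Gamma)$, where $\gamma_1(G)=G$ and $\gamma_{i+1}(G)=[\gamma_i(G),G]$. Let $W$ be the $\mathbb{Q}$-vector space with basis $V$, let $U\subseteq\bigwedge^2W$ be the subspace spanned by all $v\wedge w$ with $v,w\in V$, $vw\notin E$, and let $\mathfrak{n}_\Gamma^{\mathbb{Q}}=W\oplus U$ be the Lie algebra with $[v,w]=v\wedge w$ for $v,w\in V$ with $vw\notin E$, $[v,w]=0$ for $vw\in E$, and $[W,U]=[U,U]=0$. Let $G_\Gamma^{\mathbb{Q}}=\{e^x\mid x\in W\oplus U\}$ be the group with product $e^xe^y=e^{x+y+\frac12[x,y]}$. A rational Malcev completion of a finitely generated torsion-free nilpotent group $N$ is a torsion-free nilpotent group $N^{\mathbb{Q}}$ together with an embedding $N\hookrightarrow N^{\mathbb{Q}}$ such that for all $n\in N$ and $k\ge1$ there is a unique $m\in N^{\mathbb{Q}}$ with $m^k=n$, and for every $m\in N^{\mathbb{Q}}$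 there is a $k\ge1$ with $m^k\in N$. A group $G$ is directly indecomposable if $G\cong H\times K$ implies $H=1$ or $K=1$, and $N$ is rationally indecomposable if $N^{\mathbb{Q}}$ is directly indecomposable. The simplicial join $\Gamma_1*\Gamma_2$ of two graphs is their disjoint union together with all edges between a vertex of $\Gamma_1$ and a vertex of $\Gamma_2$; $\Gamma$ splits as a simplicial join if $\Gamma\cong\Gamma_1*\Gamma_2$ for some graphs $\Gamma_1,\Gamma_2$ with non-empty vertex sets. Proposition. Let $\Gamma$ be a finite simple graph. Then: (a) $N_\Gamma$ is finitely generated, torsion-free and nilpotent. (b) $G_\Gamma^{\mathbb{Q}}$ is the rational Malcev completion of $N_\Gamma$: there is a homomorphism $F:N_\Gamma\to G_\Gamma^{\mathbb{Q}}$ with $F(v)=e^v$ for all $v\in V$, it makes $G_\Gamma^{\mathbb{Q}}$ a rational Malcev completion of $N_\Gamma$, and for every rational Malcev completion $\varphi:N_\Gamma\hookrightarrow M$ there is an isomorphism $\theta:G_\Gamma^{\mathbb{Q}}\to M$ with $\theta\circ F=\varphi$. (c) $N_\Gamma$ is rationally indecomposable if and only if $\Gamma$ does not split as a simplicial join. 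-/

import Mathlib

universe u

/-- Torsion-free in the classical sense: only the identity has finite order. -/
def GroupIsTorsionFree (G : Type u) [Group G] : Prop :=
  ∀ g : G, ∀ k : ℕ, 0 < k → g ^ k = 1 → g = 1

/-- `φ : N →* M` exhibits `M` as a rational Malcev completion of `N`. -/
structure IsRationalCompletion {N M : Type u} [Group N] [Group M] (φ : N →* M) : Prop where
  nilpotent : Group.IsNilpotent M
  torsionFree : GroupIsTorsionFree M
  /-- `N` embeds into `M` -/
  injective : Function.Injective φ
  /-- every element of `N` has a unique `k`-th root in `M`, for each `k ≥ 1` -/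
  existsUnique_root : ∀ n : N, ∀ k : ℕ, 0 < k → ∃! m : M, m ^ k = φ n
  /-- every element of `M` has a positive power in `N` -/
  exists_pow_mem : ∀ m : M, ∃ k : ℕ, 0 < k ∧ m ^ k ∈ φ.range

/-- `G` is directly indecomposable if `G ≅ H × K` implies `H = 1` or `K = 1`. -/
def DirectlyIndecomposable (G : Type u) [Group G] : Prop :=
  ∀ (H K : Type u) [Group H] [Group K], Nonempty (G ≃* H × K) → Subsingleton H ∨ Subsingleton K

/-- `N` has a rational Malcev completion that is directly indecomposable. For a finitely generated
torsion-free nilpotent group `N` the completion exists and is unique up to isomorphism. -/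
def RationallyIndecomposable (N : Type u) [Group N] : Prop :=
  ∃ (M : Type u) (_ : Group M) (φ : N →* M), IsRationalCompletion φ ∧ DirectlyIndecomposable M

namespace SimpleGraph

variable {V : Type u}

/-- The simplicial join of two graphs, on the disjoint union of the vertex sets. -/
def simplicialJoin {V₁ V₂ : Type u} (Γ₁ : SimpleGraph V₁) (Γ₂ : SimpleGraph V₂) :
    SimpleGraph (V₁ ⊕ V₂) where
  Adj
    | .inl v, .inl w => Γ₁.Adj v w
    | .inr v, .inr w => Γ₂.Adj v w
    | .inl _, .inr _ => True
    | .inr _, .inl _ => True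
  symm := ⟨by
    rintro (v | v) (w | w) h
    · exact Γ₁.adj_symm h
    · trivial
    · trivial
    · exact Γ₂.adj_symm h⟩
  loopless := ⟨by
    rintro (v | v) h
    · exact Γ₁.loopless.irrefl v h
    · exact Γ₂.loopless.irrefl v h⟩

/-- `Γ` splits as the simplicial join of two non-trivial (that is, non-empty) graphs. -/
def SplitsAsSimplicialJoin (Γ : SimpleGraph V) : Prop :=
  ∃ (V₁ V₂ : Type u) (Γ₁ : SimpleGraph V₁) (Γ₂ : SimpleGraph V₂),
    Nonempty V₁ ∧ Nonempty V₂ ∧ Nonempty (Γ ≃g Γ₁.simplicialJoin Γ₂)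

open scoped commutatorElement in
/-- The right-angled Artin group `A_Γ`: generated by the vertices, where adjacent vertices
commute. -/
abbrev RAAG (Γ : SimpleGraph V) : Type u :=
  PresentedGroup {r : FreeGroup V | ∃ v w, Γ.Adj v w ∧ r = ⁅FreeGroup.of v, FreeGroup.of w⁆}

/-- `N_Γ = A_Γ / γ₃(A_Γ)`. Mathlib numbers the lower central series from `0`, so that
`γ₃` is the term of index `2`. -/
abbrev TwoStepQuotient (Γ : SimpleGraph V) : Type u :=
  RAAG Γ ⧸ (⊤ : Subgroup (RAAG Γ)).lowerCentralSeries 2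

/-- The image of a vertex in `N_Γ`. -/
def TwoStepQuotient.of (Γ : SimpleGraph V) (v : V) : TwoStepQuotient Γ :=
  QuotientGroup.mk (PresentedGroup.of v)

noncomputable section

/-- The exterior square `⋀² W` of the rational vector space `W` with basis `V`. -/
def ExteriorSquare (V : Type u) : Type u := ⋀[ℚ]^2 (V →₀ ℚ)

instance : AddCommGroup (ExteriorSquare V) :=
  inferInstanceAs (AddCommGroup (⋀[ℚ]^2 (V →₀ ℚ)))

instance : Module ℚ (ExteriorSquare V) :=
  inferInstanceAs (Module ℚ (⋀[ℚ]^2 (V →₀ ℚ)))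

/-- `v ∧ w` in the exterior square of `W`. -/
def wedge (v w : V) : ExteriorSquare V :=
  exteriorPower.ιMulti ℚ 2 ![Finsupp.single v 1, Finsupp.single w 1]

/-- The subspace `U` of `⋀² W` generated by the `v ∧ w` with `v`, `w` non-adjacent. -/
def wedgeSubspace (Γ : SimpleGraph V) : Submodule ℚ (ExteriorSquare V) :=
  Submodule.span ℚ {x | ∃ v w, ¬ Γ.Adj v w ∧ x = wedge v w}

open Classical in
/-- The bracket of two vertices. -/
def vertexBracket (Γ : SimpleGraph V) (v w : V) : wedgeSubspace Γ :=
  if h : Γ.Adj v w then 0 else ⟨wedge v w, Submodule.subset_span ⟨v, w, h, rfl⟩⟩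

/-- The bilinear map `W × W → U` extending the bracket of vertices. -/
def bracketBilin (Γ : SimpleGraph V) : (V →₀ ℚ) →ₗ[ℚ] (V →₀ ℚ) →ₗ[ℚ] wedgeSubspace Γ :=
  Finsupp.linearCombination ℚ fun v => Finsupp.linearCombination ℚ fun w => vertexBracket Γ v w

theorem wedge_swap (v w : V) : wedge w v = - wedge v w := by
  have h := (exteriorPower.ιMulti ℚ 2 (M := V →₀ ℚ)).map_swap
    ![Finsupp.single v 1, Finsupp.single w 1] (i := 0) (j := 1) (by decide)
  have e : (![Finsupp.single v 1, Finsupp.single w 1] : Fin 2 → V →₀ ℚ) ∘ Equiv.swap 0 1 =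
      ![Finsupp.single w 1, Finsupp.single v 1] := by
    ext i : 1
    fin_cases i <;> simp
  rw [e] at h
  exact h

theorem vertexBracket_swap (Γ : SimpleGraph V) (v w : V) :
    vertexBracket Γ w v = - vertexBracket Γ v w := by
  unfold vertexBracket
  by_cases h : Γ.Adj v w
  · rw [dif_pos h, dif_pos h.symm, neg_zero]
  · rw [dif_neg h, dif_neg (fun h' => h h'.symm)]
    exact Subtype.ext (wedge_swap v w)

theorem bracketBilin_swap (Γ : SimpleGraph V) (x y : V →₀ ℚ) :
    bracketBilin Γ y x = - bracketBilin Γ x y := by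
  have h : (bracketBilin Γ).flip = - bracketBilin Γ := by
    ext v w : 4
    simp [bracketBilin, vertexBracket_swap Γ v w]
  exact congrArg (fun f => f x y) h

theorem bracketBilin_self (Γ : SimpleGraph V) (x : V →₀ ℚ) : bracketBilin Γ x x = 0 := by
  have h : (2 : ℚ) • bracketBilin Γ x x = 0 := by
    rw [two_smul]
    exact eq_neg_iff_add_eq_zero.mp (bracketBilin_swap Γ x x)
  exact (smul_eq_zero.mp h).resolve_left two_ne_zero

/-- The underlying vector space `W ⊕ U` of the rational Lie algebra of `Γ`. -/
def GraphLieAlgebra (Γ : SimpleGraph V) : Type u := (V →₀ ℚ) × wedgeSubspace Γ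

namespace GraphLieAlgebra

variable (Γ : SimpleGraph V)

instance : AddCommGroup (GraphLieAlgebra Γ) :=
  inferInstanceAs (AddCommGroup ((V →₀ ℚ) × wedgeSubspace Γ))

instance : Module ℚ (GraphLieAlgebra Γ) :=
  inferInstanceAs (Module ℚ ((V →₀ ℚ) × wedgeSubspace Γ))

/-- The bracket on `W ⊕ U`: the bilinear extension of the bracket of vertices, with
`[W, U] = [U, U] = 0`. -/
instance : Bracket (GraphLieAlgebra Γ) (GraphLieAlgebra Γ) where
  bracket x y := (0, bracketBilin Γ x.1 y.1)

variable {Γ}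

theorem bracket_def (x y : GraphLieAlgebra Γ) :
    ⁅x, y⁆ = ((0, bracketBilin Γ x.1 y.1) : (V →₀ ℚ) × wedgeSubspace Γ) := rfl

@[ext] theorem ext {x y : GraphLieAlgebra Γ} (h₁ : x.1 = y.1) (h₂ : x.2 = y.2) : x = y :=
  Prod.ext h₁ h₂

@[simp] theorem add_fst (x y : GraphLieAlgebra Γ) : (x + y).1 = x.1 + y.1 := rfl
@[simp] theorem add_snd (x y : GraphLieAlgebra Γ) : (x + y).2 = x.2 + y.2 := rfl
@[simp] theorem neg_fst (x : GraphLieAlgebra Γ) : (-x).1 = -x.1 := rfl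
@[simp] theorem neg_snd (x : GraphLieAlgebra Γ) : (-x).2 = -x.2 := rfl
@[simp] theorem zero_fst : (0 : GraphLieAlgebra Γ).1 = 0 := rfl
@[simp] theorem zero_snd : (0 : GraphLieAlgebra Γ).2 = 0 := rfl
@[simp] theorem smul_fst (q : ℚ) (x : GraphLieAlgebra Γ) : (q • x).1 = q • x.1 := rfl
@[simp] theorem smul_snd (q : ℚ) (x : GraphLieAlgebra Γ) : (q • x).2 = q • x.2 := rfl
@[simp] theorem bracket_fst (x y : GraphLieAlgebra Γ) : ⁅x, y⁆.1 = 0 := rfl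
@[simp] theorem bracket_snd (x y : GraphLieAlgebra Γ) : ⁅x, y⁆.2 = bracketBilin Γ x.1 y.1 := rfl

variable (Γ)

/-- The vertex `v` as an element of `W ⊆ W ⊕ U`. -/
def ofVertex (v : V) : GraphLieAlgebra Γ :=
  ((Finsupp.single v 1, 0) : (V →₀ ℚ) × wedgeSubspace Γ)

@[simp] theorem ofVertex_fst (v : V) : (ofVertex Γ v).1 = Finsupp.single v 1 := rfl
@[simp] theorem ofVertex_snd (v : V) : (ofVertex Γ v).2 = 0 := rfl

instance : LieRing (GraphLieAlgebra Γ) where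
  add_lie x y z := by ext : 1 <;> simp
  lie_add x y z := by ext : 1 <;> simp
  lie_self x := by ext : 1 <;> simp [bracketBilin_self]
  leibniz_lie x y z := by ext : 1 <;> simp

instance : LieAlgebra ℚ (GraphLieAlgebra Γ) where
  lie_smul q x y := by ext : 1 <;> simp

end GraphLieAlgebra

/-- The group `G_Γ^ℚ = {e^x | x ∈ W ⊕ U}`. -/
@[ext] structure GraphMalcevGroup (Γ : SimpleGraph V) : Type u where
  /-- the element `e^x` -/
  exp ::
  /-- the exponent `x` of `e^x` -/
  log : GraphLieAlgebra Γ

namespace GraphMalcevGroup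

variable (Γ : SimpleGraph V)

/-- `e^x e^y = e^(x + y + [x, y] / 2)`. -/
instance : Mul (GraphMalcevGroup Γ) where
  mul g h := exp (g.log + h.log + (1 / 2 : ℚ) • ⁅g.log, h.log⁆)

instance : One (GraphMalcevGroup Γ) where
  one := exp 0

instance : Inv (GraphMalcevGroup Γ) where
  inv g := exp (-g.log)

variable {Γ}

@[simp] theorem log_mul (g h : GraphMalcevGroup Γ) :
    (g * h).log = g.log + h.log + (1 / 2 : ℚ) • ⁅g.log, h.log⁆ := rfl
@[simp] theorem log_one : (1 : GraphMalcevGroup Γ).log = 0 := rfl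
@[simp] theorem log_inv (g : GraphMalcevGroup Γ) : (g⁻¹).log = -g.log := rfl

variable (Γ)

instance : Group (GraphMalcevGroup Γ) :=
  Group.ofLeftAxioms
    (fun g h k => by
      ext : 1
      ext : 1
      · simp only [log_mul, GraphLieAlgebra.add_fst, GraphLieAlgebra.smul_fst,
          GraphLieAlgebra.bracket_fst, smul_zero, add_zero, zero_add, add_assoc]
      · simp only [log_mul, GraphLieAlgebra.add_snd, GraphLieAlgebra.smul_snd,
          GraphLieAlgebra.bracket_snd, GraphLieAlgebra.add_fst, GraphLieAlgebra.smul_fst,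
          GraphLieAlgebra.bracket_fst, smul_zero, add_zero, map_add, LinearMap.add_apply, smul_add]
        abel)
    (fun g => by ext : 1; simp)
    (fun g => by ext : 1; simp)

/-- The element `e^v` of `G_Γ^ℚ` for a vertex `v`. -/
def ofVertex (v : V) : GraphMalcevGroup Γ :=
  exp (GraphLieAlgebra.ofVertex Γ v)

end GraphMalcevGroup

end

end SimpleGraph

/-! `N_Γ` and `G_Γ^ℚ` have class at most two, so everything reduces to two layers, the
abelianization and the commutators, and to the bilinear bracket on `W`.

For (a) and (b), `v ↦ e^v` extends to `N_Γ` by its universal property. It is injective because the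
vertices stay linearly independent in `W` and the commutators of non-adjacent pairs stay linearly
independent in `U`; torsion-freeness of `N_Γ` is then inherited. The elements with a power in the
image form a subgroup containing all `e^(qv)`, which generate `G_Γ^ℚ`. Completions are unique
because a completion of a class two group again has class two, so in `M × M'` the elements with a
power in the diagonal image of `N` form a subgroup; it is the graph of the isomorphism
(`exists_mulEquiv`).

For (c), a join splits `N_Γ` as a product, and products of completions are completions. Conversely,
let `G_Γ^ℚ = H × K`, with projections `X`, `Y` to `W`. Then `[X, Y] = 0` and `X + Y = W`. For
non-adjacent `a`, `b` the coordinate of `[x, y]` at `a ∧ b` is a 2×2 minor. If distinct non-adjacent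
`a`, `b` lay in the supports of `X` and `Y` respectively, the vanishing of these minors would force
one nontrivial linear relation on all of `W`. So vertices in the two supports are adjacent whenever
distinct, and this yields a join. A single vertex needs a separate argument: two nonzero elements of
`ℚ` have a common nonzero multiple. -/

open scoped commutatorElement

/-! ### Roots in torsion-free nilpotent groups. -/

section Nilpotent

variable {G : Type*} [Group G]

/-- Write `⁅x, g⁆ = x * (g * x⁻¹ * g⁻¹)`. The hypothesis makes the two factors commute, so the power
can be taken factor by factor. -/
theorem commutatorElement_pow_left_of_commute {x g : G} (h : Commute ⁅x, g⁆ x) (k : ℕ) :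
    ⁅x ^ k, g⁆ = ⁅x, g⁆ ^ k := by
  have e : ⁅x, g⁆ = x * (g * x⁻¹ * g⁻¹) := by rw [commutatorElement_def]; group
  have e' : g * x⁻¹ * g⁻¹ = x⁻¹ * ⁅x, g⁆ := by rw [e]; group
  have hc : Commute x (g * x⁻¹ * g⁻¹) := by
    rw [e']
    exact ((Commute.refl x).inv_right).mul_right h.symm
  rw [e, hc.mul_pow, conj_pow, inv_pow, commutatorElement_def]
  group

/-- The successive quotients of the upper central series of a torsion-free group are
torsion-free. -/
theorem mem_upperCentralSeries_of_pow_mem_of_mem_succ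
    (hG : ∀ g : G, ∀ k : ℕ, 0 < k → g ^ k = 1 → g = 1) {k : ℕ} (hk : 0 < k) (n : ℕ) :
    ∀ x : G, x ∈ Subgroup.upperCentralSeries G (n + 1) →
      x ^ k ∈ Subgroup.upperCentralSeries G n → x ∈ Subgroup.upperCentralSeries G n := by
  induction n with
  | zero =>
    intro x _ hx
    exact Subgroup.mem_bot.mpr (hG x k hk (Subgroup.mem_bot.mp hx))
  | succ n ih =>
    intro x hx hxk
    rw [Subgroup.mem_upperCentralSeries_succ_iff] at hx hxk ⊢
    intro g
    refine ih _ (hx g) ?_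
    let π := QuotientGroup.mk' (Subgroup.upperCentralSeries G n)
    -- `⁅x, g⁆` is central modulo the `n`-th term, hence `⁅x, g⁆ ^ k` agrees there with `⁅x ^ k,
    -- g⁆`, which is trivial.
    have hc : Commute ⁅π x, π g⁆ (π x) := by
      rw [← map_commutatorElement]
      have h := Subgroup.mem_upperCentralSeries_succ_iff.mp (hx g) x
      rw [← QuotientGroup.eq_one_iff] at h
      have h' : ⁅π ⁅x, g⁆, π x⁆ = 1 := by rw [← map_commutatorElement]; exact h
      exact commutatorElement_eq_one_iff_commute.mp h'
    have h : π (⁅x, g⁆ ^ k) = π ⁅x ^ k, g⁆ := by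
      rw [map_pow, map_commutatorElement, map_commutatorElement, map_pow,
        commutatorElement_pow_left_of_commute hc]
    have h1 : π ⁅x ^ k, g⁆ = 1 := (QuotientGroup.eq_one_iff _).mpr (hxk g)
    exact (QuotientGroup.eq_one_iff _).mp (h.trans h1)

variable [Group.IsNilpotent G]

/-- By nilpotency `x` lies in some higher term of the series; torsion-freeness of the successive
quotients brings it down one term at a time. -/
theorem mem_upperCentralSeries_of_pow_mem
    (hG : ∀ g : G, ∀ k : ℕ, 0 < k → g ^ k = 1 → g = 1) {k : ℕ} (hk : 0 < k) {n : ℕ} {x : G}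
    (hx : x ^ k ∈ Subgroup.upperCentralSeries G n) : x ∈ Subgroup.upperCentralSeries G n := by
  obtain ⟨c, hc⟩ := Group.IsNilpotent.nilpotent G
  have key : ∀ j, x ∈ Subgroup.upperCentralSeries G (n + j) →
      x ∈ Subgroup.upperCentralSeries G n := by
    intro j
    induction j with
    | zero => exact id
    | succ j ih =>
      intro h
      exact ih (mem_upperCentralSeries_of_pow_mem_of_mem_succ hG hk _ x h
        (Subgroup.upperCentralSeries_mono G (Nat.le_add_right n j) hx))
  refine key c (Subgroup.upperCentralSeries_mono G (Nat.le_add_left c n) ?_)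
  rw [hc]
  exact Subgroup.mem_top x

/-- Roots are unique in torsion-free nilpotent groups. -/
theorem eq_of_pow_eq_pow_of_isNilpotent
    (hG : ∀ g : G, ∀ k : ℕ, 0 < k → g ^ k = 1 → g = 1) {k : ℕ} (hk : 0 < k) {x y : G}
    (h : x ^ k = y ^ k) : x = y := by
  obtain ⟨c, hc⟩ := Group.IsNilpotent.nilpotent G
  -- Descent along the series: if `x * y⁻¹` is central modulo the `n`-th term, then there `x ^ k =
  -- (x * y⁻¹) ^ k * y ^ k`, so `(x * y⁻¹) ^ k` lies in that term, and hence so does `x * y⁻¹`.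
  have key : ∀ n, x * y⁻¹ ∈ Subgroup.upperCentralSeries G n → x * y⁻¹ = 1 := by
    intro n
    induction n with
    | zero => exact Subgroup.mem_bot.mp
    | succ n ih =>
      intro hxy
      refine ih (mem_upperCentralSeries_of_pow_mem hG hk ?_)
      let π := QuotientGroup.mk' (Subgroup.upperCentralSeries G n)
      have hcomm : Commute (π (x * y⁻¹)) (π y) := by
        have h' := Subgroup.mem_upperCentralSeries_succ_iff.mp hxy y
        rw [← QuotientGroup.eq_one_iff] at h'
        have h'' : ⁅π (x * y⁻¹), π y⁆ = 1 := by rw [← map_commutatorElement]; exact h'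
        exact commutatorElement_eq_one_iff_commute.mp h''
      have e : π x = π (x * y⁻¹) * π y := by rw [← map_mul]; group
      have e1 : π (x ^ k) = π ((x * y⁻¹) ^ k) * π (y ^ k) := by
        rw [map_pow, e, hcomm.mul_pow, map_pow, map_pow]
      rw [h] at e1
      exact (QuotientGroup.eq_one_iff _).mp (right_eq_mul.mp e1)
  refine mul_inv_eq_one.mp (key c ?_)
  rw [hc]
  exact Subgroup.mem_top _

/-- The elements `x` and `y * x * y⁻¹` have the same `k`-th power, and roots are unique. -/
theorem commute_of_commute_pow_left
    (hG : ∀ g : G, ∀ k : ℕ, 0 < k → g ^ k = 1 → g = 1) {k : ℕ} (hk : 0 < k) {x y : G}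
    (h : Commute (x ^ k) y) : Commute x y := by
  have h1 : (y * x * y⁻¹) ^ k = x ^ k := by
    rw [conj_pow, ← h.eq, mul_inv_cancel_right]
  have h2 := eq_of_pow_eq_pow_of_isNilpotent hG hk h1
  exact (mul_inv_eq_iff_eq_mul.mp h2).symm

theorem commute_of_commute_pow_pow
    (hG : ∀ g : G, ∀ k : ℕ, 0 < k → g ^ k = 1 → g = 1) {k l : ℕ} (hk : 0 < k) (hl : 0 < l)
    {x y : G} (h : Commute (x ^ k) (y ^ l)) : Commute x y :=
  (commute_of_commute_pow_left hG hl (commute_of_commute_pow_left hG hk h).symm).symm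

theorem mem_center_of_pow_mem_center
    (hG : ∀ g : G, ∀ k : ℕ, 0 < k → g ^ k = 1 → g = 1) {k : ℕ} (hk : 0 < k) {x : G}
    (hx : x ^ k ∈ Subgroup.center G) : x ∈ Subgroup.center G := by
  rw [← Subgroup.upperCentralSeries_one] at hx ⊢
  exact mem_upperCentralSeries_of_pow_mem hG hk hx

end Nilpotent

/-! ### Groups of class at most two and isolators. -/

/-- A group is nilpotent of class at most two if its commutators are central. -/
def IsClassTwo (G : Type*) [Group G] : Prop :=
  ∀ x y z : G, Commute ⁅x, y⁆ z

namespace IsClassTwo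

variable {G : Type*} [Group G]

theorem prod {H : Type*} [Group H] (hG : IsClassTwo G) (hH : IsClassTwo H) :
    IsClassTwo (G × H) := fun x y z =>
  Prod.ext (hG x.1 y.1 z.1) (hH x.2 y.2 z.2)

theorem lowerCentralSeries_eq_bot (hG : IsClassTwo G) :
    (⊤ : Subgroup G).lowerCentralSeries 2 = ⊥ := by
  rw [Subgroup.lowerCentralSeries_succ, Subgroup.top_lowerCentralSeries_one,
    Subgroup.commutator_eq_bot_iff_le_centralizer, commutator_def, Subgroup.commutator_le]
  intro x _ y _
  rw [Subgroup.mem_centralizer_iff]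
  intro z _
  exact ((hG x y z).eq).symm

theorem of_lowerCentralSeries_eq_bot (h : (⊤ : Subgroup G).lowerCentralSeries 2 = ⊥) :
    IsClassTwo G := by
  intro x y z
  rw [← commutatorElement_eq_one_iff_commute, ← Subgroup.mem_bot, ← h]
  exact Subgroup.commutator_mem_commutator
    (Subgroup.commutator_mem_commutator (Subgroup.mem_top x) (Subgroup.mem_top y))
    (Subgroup.mem_top z)

theorem isNilpotent (hG : IsClassTwo G) : Group.IsNilpotent G :=
  Subgroup.nilpotent_iff_lowerCentralSeries.mpr ⟨2, hG.lowerCentralSeries_eq_bot⟩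

theorem commutatorElement_pow_left (hG : IsClassTwo G) (x y : G) (k : ℕ) :
    ⁅x ^ k, y⁆ = ⁅x, y⁆ ^ k :=
  commutatorElement_pow_left_of_commute (hG x y x) k

theorem commutatorElement_pow_right (hG : IsClassTwo G) (x y : G) (k : ℕ) :
    ⁅x, y ^ k⁆ = ⁅x, y⁆ ^ k := by
  rw [← commutatorElement_inv, hG.commutatorElement_pow_left, ← inv_pow, commutatorElement_inv]

/-- Collecting the factors `g` on the left costs one central commutator for each `h` that is passed;
the binomial coefficient counts these. -/
theorem mul_pow (hG : IsClassTwo G) (g h : G) (n : ℕ) :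
    (g * h) ^ n = g ^ n * h ^ n * ⁅h, g⁆ ^ n.choose 2 := by
  induction n with
  | zero => simp
  | succ n ih =>
    have e : h ^ n * g = g * h ^ n * ⁅h, g⁆ ^ n := by
      rw [← hG.commutatorElement_pow_left, ← (hG (h ^ n) g (g * h ^ n)).eq, commutatorElement_def]
      group
    have hc : Nat.choose (n + 1) 2 = n + n.choose 2 := by
      rw [Nat.choose_succ_succ' n 1, Nat.choose_one_right]
    calc (g * h) ^ (n + 1) = g ^ n * h ^ n * (⁅h, g⁆ ^ n.choose 2 * (g * h)) := by
          rw [pow_succ, ih]; group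
      _ = g ^ n * (h ^ n * g) * h * ⁅h, g⁆ ^ n.choose 2 := by
          rw [((hG h g (g * h)).pow_left _).eq]; group
      _ = g ^ (n + 1) * h ^ n * (⁅h, g⁆ ^ n * h) * ⁅h, g⁆ ^ n.choose 2 := by
          rw [e]; group
      _ = _ := by
          rw [((hG h g h).pow_left _).eq, hc, pow_add, pow_succ h]
          group

/-- The elements with a positive power in a given subgroup. -/
def isolator (hG : IsClassTwo G) (H : Subgroup G) : Subgroup G where
  carrier := {g | ∃ k : ℕ, 0 < k ∧ g ^ k ∈ H}
  one_mem' := ⟨1, one_pos, by simp⟩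
  inv_mem' := by
    rintro g ⟨k, hk, hg⟩
    exact ⟨k, hk, by rw [inv_pow]; exact H.inv_mem hg⟩
  mul_mem' := by
    rintro g h ⟨j, hj, hg⟩ ⟨k, hk, hh⟩
    -- The factor 2 makes the binomial coefficient of `2 * j * k` over 2 a multiple of `j * k`, so
    -- the correction term is a power of `⁅h ^ k, g ^ j⁆`, which lies in `H`.
    refine ⟨2 * j * k, by positivity, ?_⟩
    have hc : (2 * j * k).choose 2 = j * k * (2 * j * k - 1) := by
      rw [Nat.choose_two_right, mul_assoc 2, mul_assoc 2, Nat.mul_div_cancel_left _ two_pos]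
    have e : ⁅h, g⁆ ^ (2 * j * k).choose 2 = ⁅h ^ k, g ^ j⁆ ^ (2 * j * k - 1) := by
      rw [hc, hG.commutatorElement_pow_left, hG.commutatorElement_pow_right, ← pow_mul,
        ← pow_mul, ← mul_assoc]
    rw [hG.mul_pow, e]
    refine H.mul_mem (H.mul_mem ?_ ?_) (H.pow_mem ?_ _)
    · rw [show 2 * j * k = j * (2 * k) by ring, pow_mul]
      exact H.pow_mem hg _
    · rw [show 2 * j * k = k * (2 * j) by ring, pow_mul]
      exact H.pow_mem hh _
    · rw [commutatorElement_def]
      exact H.mul_mem (H.mul_mem (H.mul_mem hh hg) (H.inv_mem hh)) (H.inv_mem hg)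

theorem mem_isolator {hG : IsClassTwo G} {H : Subgroup G} {g : G} :
    g ∈ hG.isolator H ↔ ∃ k : ℕ, 0 < k ∧ g ^ k ∈ H := Iff.rfl

end IsClassTwo

/-! ### Uniqueness and products of rational completions. -/

namespace IsRationalCompletion

variable {N M : Type u} [Group N] [Group M]

/-- Commutation of powers implies commutation. Applied in `M`, this makes commutators from `N`
central; applied in the quotient by the center, which is torsion-free as well, it makes that
quotient abelian. -/
theorem isClassTwo {φ : N →* M} (h : IsRationalCompletion φ) (hN : IsClassTwo N) :
    IsClassTwo M := by
  have := h.nilpotent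
  have htf := h.torsionFree
  have hcenter : ∀ a b : N, ⁅φ a, φ b⁆ ∈ Subgroup.center M := by
    intro a b
    rw [Subgroup.mem_center_iff]
    intro z
    obtain ⟨k, hk, n, hn⟩ := h.exists_pow_mem z
    refine commute_of_commute_pow_left htf hk ?_
    rw [← hn, ← map_commutatorElement]
    exact (hN a b n).symm.map φ
  let π := QuotientGroup.mk' (Subgroup.center M)
  have hQ : ∀ g : M ⧸ Subgroup.center M, ∀ k : ℕ, 0 < k → g ^ k = 1 → g = 1 := by
    intro g k hk hg
    obtain ⟨m, rfl⟩ := QuotientGroup.mk_surjective g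
    rw [← QuotientGroup.mk_pow, QuotientGroup.eq_one_iff] at hg
    exact (QuotientGroup.eq_one_iff m).mpr (mem_center_of_pow_mem_center htf hk hg)
  have hmem : ∀ x y : M, ⁅x, y⁆ ∈ Subgroup.center M := by
    intro x y
    obtain ⟨k, hk, a, ha⟩ := h.exists_pow_mem x
    obtain ⟨l, hl, b, hb⟩ := h.exists_pow_mem y
    have hxy : Commute (π x) (π y) := by
      refine commute_of_commute_pow_pow hQ hk hl ?_
      rw [← map_pow, ← map_pow, ← ha, ← hb, ← commutatorElement_eq_one_iff_commute,
        ← map_commutatorElement]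
      exact (QuotientGroup.eq_one_iff _).mpr (hcenter a b)
    rw [← commutatorElement_eq_one_iff_commute, ← map_commutatorElement] at hxy
    exact (QuotientGroup.eq_one_iff _).mp hxy
  intro x y z
  exact (Subgroup.mem_center_iff.mp (hmem x y) z).symm

/-- Any two rational Malcev completions are isomorphic, compatibly with the embeddings. -/
theorem exists_mulEquiv {M' : Type u} [Group M'] {φ : N →* M} {ψ : N →* M'}
    (hφ : IsRationalCompletion φ) (hψ : IsRationalCompletion ψ) (hN : IsClassTwo N) :
    ∃ e : M ≃* M', e.toMonoidHom.comp φ = ψ := by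
  -- The graph of the isomorphism sought: pairs with a common power coming from one element of `N`.
  -- Both projections are bijective, by existence of roots and by torsion-freeness.
  let R := ((hφ.isClassTwo hN).prod (hψ.isClassTwo hN)).isolator (φ.prod ψ).range
  have memR : ∀ p : M × M', p ∈ R ↔ ∃ k : ℕ, 0 < k ∧ ∃ n, φ n = p.1 ^ k ∧ ψ n = p.2 ^ k := by
    intro p
    simp only [R, IsClassTwo.mem_isolator, MonoidHom.mem_range, Prod.ext_iff, MonoidHom.prod_apply,
      Prod.pow_fst, Prod.pow_snd]
  have h1 : Function.Bijective ((MonoidHom.fst M M').comp R.subtype) := by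
    constructor
    · rw [injective_iff_map_eq_one]
      rintro ⟨⟨m, m'⟩, hm⟩ (rfl : m = 1)
      obtain ⟨k, hk, n, hn, hn'⟩ := (memR _).mp hm
      rw [one_pow, ← map_one φ] at hn
      rw [hφ.injective hn, map_one] at hn'
      obtain rfl : m' = 1 := hψ.torsionFree m' k hk hn'.symm
      rfl
    · intro m
      obtain ⟨k, hk, n, hn⟩ := hφ.exists_pow_mem m
      obtain ⟨m', hm', -⟩ := hψ.existsUnique_root n k hk
      exact ⟨⟨(m, m'), (memR _).mpr ⟨k, hk, n, hn, hm'.symm⟩⟩, rfl⟩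
  have h2 : Function.Bijective ((MonoidHom.snd M M').comp R.subtype) := by
    constructor
    · rw [injective_iff_map_eq_one]
      rintro ⟨⟨m, m'⟩, hm⟩ (rfl : m' = 1)
      obtain ⟨k, hk, n, hn, hn'⟩ := (memR _).mp hm
      rw [one_pow, ← map_one ψ] at hn'
      rw [hψ.injective hn', map_one] at hn
      obtain rfl : m = 1 := hφ.torsionFree m k hk hn.symm
      rfl
    · intro m'
      obtain ⟨k, hk, n, hn⟩ := hψ.exists_pow_mem m'
      obtain ⟨m, hm, -⟩ := hφ.existsUnique_root n k hk
      exact ⟨⟨(m, m'), (memR _).mpr ⟨k, hk, n, hm.symm, hn⟩⟩, rfl⟩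
  refine ⟨(MulEquiv.ofBijective _ h1).symm.trans (MulEquiv.ofBijective _ h2), ?_⟩
  ext n
  have hn : (φ n, ψ n) ∈ R := (memR _).mpr ⟨1, one_pos, n, by simp, by simp⟩
  have e : (MulEquiv.ofBijective _ h1).symm (φ n) = ⟨(φ n, ψ n), hn⟩ :=
    (MulEquiv.symm_apply_eq _).mpr rfl
  exact congrArg (MulEquiv.ofBijective _ h2) e

theorem prodMap {N' M' : Type u} [Group N'] [Group M'] {φ : N →* M} {ψ : N' →* M'}
    (hφ : IsRationalCompletion φ) (hψ : IsRationalCompletion ψ) :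
    IsRationalCompletion (φ.prodMap ψ) where
  nilpotent := by
    have := hφ.nilpotent
    have := hψ.nilpotent
    infer_instance
  torsionFree g k hk hg :=
    Prod.ext (hφ.torsionFree g.1 k hk (congrArg Prod.fst hg))
      (hψ.torsionFree g.2 k hk (congrArg Prod.snd hg))
  injective := hφ.injective.prodMap hψ.injective
  existsUnique_root n k hk := by
    obtain ⟨m, hm, hu⟩ := hφ.existsUnique_root n.1 k hk
    obtain ⟨m', hm', hu'⟩ := hψ.existsUnique_root n.2 k hk
    exact ⟨(m, m'), Prod.ext hm hm', fun p hp =>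
      Prod.ext (hu p.1 (congrArg Prod.fst hp)) (hu' p.2 (congrArg Prod.snd hp))⟩
  exists_pow_mem m := by
    obtain ⟨k, hk, n, hn⟩ := hφ.exists_pow_mem m.1
    obtain ⟨l, hl, n', hn'⟩ := hψ.exists_pow_mem m.2
    refine ⟨k * l, Nat.mul_pos hk hl, (n ^ l, n' ^ k), Prod.ext ?_ ?_⟩
    · simp [hn, pow_mul]
    · simp [hn', pow_mul, mul_comm k l]

theorem comp_mulEquiv {N' : Type u} [Group N'] {φ : N →* M} (h : IsRationalCompletion φ)
    (e : N' ≃* N) : IsRationalCompletion (φ.comp e.toMonoidHom) where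
  nilpotent := h.nilpotent
  torsionFree := h.torsionFree
  injective := h.injective.comp e.injective
  existsUnique_root n := h.existsUnique_root (e n)
  exists_pow_mem m := by
    obtain ⟨k, hk, n, hn⟩ := h.exists_pow_mem m
    exact ⟨k, hk, e.symm n, by simp [hn]⟩

end IsRationalCompletion

/-- Modulo `S` the generators commute with each other, so the quotient is abelian. -/
theorem commutator_le_of_closure_eq_top {G : Type*} [Group G] {s : Set G}
    (hs : Subgroup.closure s = ⊤) (S : Subgroup G) [S.Normal]
    (h : ∀ x ∈ s, ∀ y ∈ s, ⁅x, y⁆ ∈ S) : commutator G ≤ S := by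
  let π := QuotientGroup.mk' S
  have hπ : ∀ x y, ⁅x, y⁆ ∈ S ↔ Commute (π x) (π y) := by
    intro x y
    rw [← commutatorElement_eq_one_iff_commute, ← map_commutatorElement]
    exact (QuotientGroup.eq_one_iff _).symm
  have key : ∀ z : G ⧸ S, (∀ x ∈ s, Commute (π x) z) → ∀ x, Commute (π x) z := by
    intro z hz x
    have hx : x ∈ Subgroup.closure s := hs ▸ Subgroup.mem_top x
    induction hx using Subgroup.closure_induction with
    | mem x hx => exact hz x hx
    | one => rw [map_one]; exact Commute.one_left z
    | mul x y _ _ hx hy => rw [map_mul]; exact hx.mul_left hy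
    | inv x _ hx => rw [map_inv]; exact hx.inv_left
  rw [commutator_def, Subgroup.commutator_le]
  intro x _ y _
  rw [hπ]
  exact key (π y) (fun x' hx' => (key (π x') (fun y' hy' =>
    (hπ y' x').mp (h y' hy' x' hx')) y).symm) x

/-! ### Generators and universal property of `N_Γ`. -/

namespace SimpleGraph

variable {V : Type u}

/-- The defining relators of `A_Γ`. -/
abbrev raagRelators (Γ : SimpleGraph V) : Set (FreeGroup V) :=
  {r : FreeGroup V | ∃ v w, Γ.Adj v w ∧ r = ⁅FreeGroup.of v, FreeGroup.of w⁆}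

namespace TwoStepQuotient

variable (Γ : SimpleGraph V)

theorem isClassTwo : IsClassTwo Γ.TwoStepQuotient := by
  refine IsClassTwo.of_lowerCentralSeries_eq_bot ?_
  have h := Subgroup.map_lowerCentralSeries (⊤ : Subgroup (RAAG Γ))
    (QuotientGroup.mk' ((⊤ : Subgroup (RAAG Γ)).lowerCentralSeries 2)) 2
  rw [Subgroup.map_top_of_surjective _ (QuotientGroup.mk'_surjective _)] at h
  rw [← h, QuotientGroup.map_mk'_self]

theorem closure_range_of : Subgroup.closure (Set.range (of Γ)) = ⊤ := by
  have h := congrArg (Subgroup.map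
    (QuotientGroup.mk' ((⊤ : Subgroup (RAAG Γ)).lowerCentralSeries 2)))
    (PresentedGroup.closure_range_of Γ.raagRelators)
  rw [Subgroup.map_top_of_surjective _ (QuotientGroup.mk'_surjective _), MonoidHom.map_closure,
    ← Set.range_comp] at h
  exact h

theorem fg [Finite V] : Group.FG Γ.TwoStepQuotient :=
  Group.fg_iff.mpr ⟨_, closure_range_of Γ, Set.finite_range _⟩

variable {Γ}

theorem commute_of {v w : V} (h : Γ.Adj v w) : Commute (of Γ v) (of Γ w) := by
  rw [← commutatorElement_eq_one_iff_commute]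
  have h1 : ⁅(PresentedGroup.of v : RAAG Γ), (PresentedGroup.of w : RAAG Γ)⁆ = 1 :=
    PresentedGroup.one_of_mem (rels := Γ.raagRelators)
      (x := ⁅FreeGroup.of v, FreeGroup.of w⁆) ⟨v, w, h, rfl⟩
  have h2 := congrArg (QuotientGroup.mk' ((⊤ : Subgroup (RAAG Γ)).lowerCentralSeries 2)) h1
  rw [map_commutatorElement, map_one] at h2
  exact h2

variable {G : Type*} [Group G]

theorem hom_ext {f g : Γ.TwoStepQuotient →* G} (h : ∀ v, f (of Γ v) = g (of Γ v)) : f = g :=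
  MonoidHom.eq_of_eqOn_dense (closure_range_of Γ) (by rintro _ ⟨v, rfl⟩; exact h v)

theorem lift_raagRelators {f : V → G} (hf : ∀ v w, Γ.Adj v w → Commute (f v) (f w)) :
    ∀ r ∈ Γ.raagRelators, FreeGroup.lift f r = 1 := by
  rintro _ ⟨v, w, h, rfl⟩
  rw [map_commutatorElement, FreeGroup.lift_apply_of, FreeGroup.lift_apply_of]
  exact commutatorElement_eq_one_iff_commute.mpr (hf v w h)

/-- A map from the vertices to a group of class at most two that sends adjacent vertices to
commuting elements extends to `N_Γ`. -/
def lift (hG : IsClassTwo G) (f : V → G) (hf : ∀ v w, Γ.Adj v w → Commute (f v) (f w)) :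
    Γ.TwoStepQuotient →* G :=
  QuotientGroup.lift _ (PresentedGroup.toGroup (lift_raagRelators hf)) (by
    intro x hx
    have h := Subgroup.mem_map_of_mem (PresentedGroup.toGroup (lift_raagRelators hf)) hx
    rw [Subgroup.map_lowerCentralSeries] at h
    have h' : _ ∈ (⊤ : Subgroup G).lowerCentralSeries 2 :=
      Subgroup.lowerCentralSeries_mono 2 le_top h
    rw [hG.lowerCentralSeries_eq_bot] at h'
    exact Subgroup.mem_bot.mp h')

@[simp] theorem lift_of (hG : IsClassTwo G) (f : V → G)
    (hf : ∀ v w, Γ.Adj v w → Commute (f v) (f w)) (v : V) : lift hG f hf (of Γ v) = f v :=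
  PresentedGroup.toGroup.of (lift_raagRelators hf)

end TwoStepQuotient

/-! ### Coordinates of the bracket. -/

noncomputable section

/-- The coordinate functional of `a ∧ b` on the exterior square. -/
def wedgeCoeff (a b : V) : ExteriorSquare V →ₗ[ℚ] ℚ :=
  exteriorPower.alternatingMapLinearEquiv
    (Matrix.detRowAlternating.compLinearMap
      (LinearMap.pi ![Finsupp.lapply a, Finsupp.lapply b]) : (V →₀ ℚ) [⋀^Fin 2]→ₗ[ℚ] ℚ)

theorem wedgeCoeff_wedge (a b v w : V) :
    wedgeCoeff a b (wedge v w) =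
      Finsupp.single v 1 a * Finsupp.single w 1 b - Finsupp.single v 1 b * Finsupp.single w 1 a := by
  refine (exteriorPower.alternatingMapLinearEquiv_apply_ιMulti _ _).trans ?_
  refine (Matrix.det_fin_two _).trans ?_
  simp

theorem bracketBilin_single (Γ : SimpleGraph V) (v w : V) (p q : ℚ) :
    bracketBilin Γ (Finsupp.single v p) (Finsupp.single w q) = (p * q) • vertexBracket Γ v w := by
  simp [bracketBilin, mul_smul]

theorem wedgeCoeff_vertexBracket {Γ : SimpleGraph V} {a b : V} (h : ¬ Γ.Adj a b) (v w : V) :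
    wedgeCoeff a b (vertexBracket Γ v w) =
      Finsupp.single v 1 a * Finsupp.single w 1 b - Finsupp.single v 1 b * Finsupp.single w 1 a := by
  classical
  unfold vertexBracket
  split_ifs with hvw
  · have h1 : ¬ (v = a ∧ w = b) := by rintro ⟨rfl, rfl⟩; exact h hvw
    have h2 : ¬ (v = b ∧ w = a) := by rintro ⟨rfl, rfl⟩; exact h hvw.symm
    simp only [Submodule.coe_zero, map_zero, Finsupp.single_apply]
    split_ifs <;> simp_all
  · exact wedgeCoeff_wedge a b v w

/-- Killing the adjacent wedges does not affect a non-adjacent coordinate, so the usual minor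
remains. This detects commutators in the proof of injectivity and produces the linear relations in
the splitting argument. -/
theorem wedgeCoeff_bracketBilin {Γ : SimpleGraph V} {a b : V} (h : ¬ Γ.Adj a b)
    (x y : V →₀ ℚ) : wedgeCoeff a b (bracketBilin Γ x y) = x a * y b - x b * y a := by
  induction x using Finsupp.induction_linear with
  | zero => simp
  | add x₁ x₂ h₁ h₂ =>
    simp only [map_add, LinearMap.add_apply, Submodule.coe_add, h₁, h₂, Finsupp.add_apply]
    ring
  | single v p =>
    induction y using Finsupp.induction_linear with
    | zero => simp
    | add y₁ y₂ h₁ h₂ =>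
      simp only [map_add, Submodule.coe_add, h₁, h₂, Finsupp.add_apply]
      ring
    | single w q =>
      have e (v : V) (p : ℚ) : Finsupp.single v p = p • Finsupp.single v 1 := by simp
      rw [bracketBilin_single, Submodule.coe_smul, map_smul, wedgeCoeff_vertexBracket h, e v p,
        e w q]
      simp only [Finsupp.smul_apply, smul_eq_mul]
      ring

namespace GraphLieAlgebra

variable (Γ : SimpleGraph V)

/-- The inclusion of `W` in `W ⊕ U`. -/
def inl : (V →₀ ℚ) →ₗ[ℚ] GraphLieAlgebra Γ := LinearMap.inl ℚ (V →₀ ℚ) (wedgeSubspace Γ)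

/-- The inclusion of `U` in `W ⊕ U`. -/
def inr : wedgeSubspace Γ →ₗ[ℚ] GraphLieAlgebra Γ := LinearMap.inr ℚ (V →₀ ℚ) (wedgeSubspace Γ)

@[simp] theorem inl_fst (x : V →₀ ℚ) : (inl Γ x).1 = x := rfl
@[simp] theorem inl_snd (x : V →₀ ℚ) : (inl Γ x).2 = 0 := rfl
@[simp] theorem inr_fst (x : wedgeSubspace Γ) : (inr Γ x).1 = 0 := rfl
@[simp] theorem inr_snd (x : wedgeSubspace Γ) : (inr Γ x).2 = x := rfl

theorem bracket_eq_inr (x y : GraphLieAlgebra Γ) : ⁅x, y⁆ = inr Γ (bracketBilin Γ x.1 y.1) := rfl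

end GraphLieAlgebra

/-! ### Powers, commutators and generators of `G_Γ^ℚ`. -/

namespace GraphMalcevGroup

open GraphLieAlgebra

variable {Γ : SimpleGraph V}

theorem log_pow (g : GraphMalcevGroup Γ) (k : ℕ) : (g ^ k).log = (k : ℚ) • g.log := by
  induction k with
  | zero => simp
  | succ k ih => rw [pow_succ, log_mul, ih, smul_lie, lie_self]; simp [add_smul]

theorem log_zpow (g : GraphMalcevGroup Γ) (k : ℤ) : (g ^ k).log = (k : ℚ) • g.log := by
  cases k with
  | ofNat k => simpa using log_pow g k
  | negSucc k => rw [zpow_negSucc, log_inv, log_pow, Int.cast_negSucc, neg_smul]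

theorem log_commutatorElement (g h : GraphMalcevGroup Γ) : ⁅g, h⁆.log = ⁅g.log, h.log⁆ := by
  have e : ⁅g, h⁆ = exp ⁅g.log, h.log⁆ := by
    rw [commutatorElement_def, mul_inv_eq_iff_eq_mul, mul_inv_eq_iff_eq_mul, mul_assoc]
    ext : 1
    simp only [log_mul, lie_add, lie_smul]
    ext : 1
    · simp only [add_fst, smul_fst, bracket_fst, smul_zero, add_zero, zero_add]
      exact add_comm _ _
    · simp only [add_snd, smul_snd, bracket_snd, bracket_fst, map_zero, LinearMap.zero_apply,
        smul_zero, add_zero, bracketBilin_swap Γ g.log.1 h.log.1]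
      module
  rw [e]

theorem commute_iff {g h : GraphMalcevGroup Γ} :
    Commute g h ↔ bracketBilin Γ g.log.1 h.log.1 = 0 := by
  rw [← commutatorElement_eq_one_iff_commute, GraphMalcevGroup.ext_iff, log_commutatorElement,
    log_one]
  exact ⟨fun e => congrArg (fun x : GraphLieAlgebra Γ => x.2) e, fun e => GraphLieAlgebra.ext rfl e⟩

theorem log_mul_of_commute {g h : GraphMalcevGroup Γ} (hc : Commute g h) :
    (g * h).log = g.log + h.log := by
  rw [log_mul, bracket_eq_inr, commute_iff.mp hc, map_zero, smul_zero, add_zero]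

variable (Γ)

theorem isClassTwo : IsClassTwo (GraphMalcevGroup Γ) := by
  intro x y z
  rw [commute_iff, log_commutatorElement, bracket_fst, map_zero, LinearMap.zero_apply]

variable {Γ}

theorem eq_of_pow_eq_pow {k : ℕ} (hk : 0 < k) {g h : GraphMalcevGroup Γ} (e : g ^ k = h ^ k) :
    g = h := by
  have e' := congrArg log e
  rw [log_pow, log_pow] at e'
  exact GraphMalcevGroup.ext (smul_right_injective _ (Nat.cast_ne_zero.mpr hk.ne') e')

theorem groupIsTorsionFree : GroupIsTorsionFree (GraphMalcevGroup Γ) := fun _ k hk h =>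
  eq_of_pow_eq_pow hk (h.trans (one_pow k).symm)

theorem existsUnique_root (g : GraphMalcevGroup Γ) {k : ℕ} (hk : 0 < k) :
    ∃! m : GraphMalcevGroup Γ, m ^ k = g := by
  refine ⟨exp ((k : ℚ)⁻¹ • g.log), ?_, fun m hm => ?_⟩
  all_goals
    have hk' : (k : ℚ) ≠ 0 := Nat.cast_ne_zero.mpr hk.ne'
  · ext : 1
    rw [log_pow, smul_inv_smul₀ hk']
  · ext : 1
    rw [← hm, log_pow, inv_smul_smul₀ hk']

theorem exp_inr_mem {R : Subgroup (GraphMalcevGroup Γ)}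
    (hR : ∀ (q : ℚ) (v w : V), exp (inr Γ (q • vertexBracket Γ v w)) ∈ R)
    (x : wedgeSubspace Γ) : exp (inr Γ x) ∈ R := by
  have hadd : ∀ x y : wedgeSubspace Γ,
      exp (inr Γ (x + y)) = exp (inr Γ x) * exp (inr Γ y) := fun x y => by
    ext : 1
    rw [log_mul_of_commute (commute_iff.mpr (by simp)), map_add]
  -- A subgroup need not be closed under rational scaling, so the span induction carries all
  -- rational multiples along.
  suffices h : ∀ (q : ℚ), exp (inr Γ (q • x)) ∈ R by simpa using h 1
  obtain ⟨x, hx⟩ := x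
  induction hx using Submodule.span_induction with
  | mem x h =>
    obtain ⟨v, w, hvw, rfl⟩ := h
    intro q
    have h := hR q v w
    rw [vertexBracket, dif_neg hvw] at h
    exact h
  | zero =>
    intro q
    have e : exp (inr Γ (q • (⟨0, Submodule.zero_mem _⟩ : wedgeSubspace Γ))) = 1 := by
      ext : 1
      exact (congrArg (inr Γ) (smul_zero q)).trans (map_zero _)
    rw [e]
    exact R.one_mem
  | add x y hx hy h₁ h₂ =>
    intro q
    have e : q • (⟨x + y, Submodule.add_mem _ hx hy⟩ : wedgeSubspace Γ) =
      q • (⟨x, hx⟩ : wedgeSubspace Γ) + q • (⟨y, hy⟩ : wedgeSubspace Γ) := smul_add q (⟨x, hx⟩ : wedgeSubspace Γ) ⟨y, hy⟩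
    rw [e, hadd]
    exact R.mul_mem (h₁ q) (h₂ q)
  | smul p x hx h =>
    intro q
    have e : q • (⟨p • x, Submodule.smul_mem _ p hx⟩ : wedgeSubspace Γ) =
      (q * p) • (⟨x, hx⟩ : wedgeSubspace Γ) := (mul_smul q p (⟨x, hx⟩ : wedgeSubspace Γ)).symm
    rw [e]
    exact h _

theorem commutatorElement_exp_smul_ofVertex (p q : ℚ) (v w : V) :
    ⁅exp (p • GraphLieAlgebra.ofVertex Γ v), exp (q • GraphLieAlgebra.ofVertex Γ w)⁆ =
      exp (inr Γ ((p * q) • vertexBracket Γ v w)) := by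
  ext : 1
  rw [log_commutatorElement, bracket_eq_inr]
  simp [bracketBilin_single]

theorem exp_inr_mem_commutator (x : wedgeSubspace Γ) :
    exp (inr Γ x) ∈ commutator (GraphMalcevGroup Γ) := by
  refine exp_inr_mem (fun q v w => ?_) x
  rw [← mul_one q, ← commutatorElement_exp_smul_ofVertex]
  exact Subgroup.commutator_mem_commutator (Subgroup.mem_top _) (Subgroup.mem_top _)

/-- Commutators of the given elements fill `e^U`; sums in `W` are then reached through `e^(x + y) =
e^x e^y e^(-[x, y] / 2)`. -/
theorem eq_top_of_exp_smul_ofVertex_mem {R : Subgroup (GraphMalcevGroup Γ)}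
    (hR : ∀ (q : ℚ) (v : V), exp (q • GraphLieAlgebra.ofVertex Γ v) ∈ R) : R = ⊤ := by
  have hr : ∀ x, exp (inr Γ x) ∈ R := exp_inr_mem fun q v w => by
    rw [← mul_one q, ← commutatorElement_exp_smul_ofVertex, commutatorElement_def]
    exact R.mul_mem (R.mul_mem (R.mul_mem (hR _ _) (hR _ _)) (R.inv_mem (hR _ _)))
      (R.inv_mem (hR _ _))
  have hl : ∀ x, exp (inl Γ x) ∈ R := by
    intro x
    induction x using Finsupp.induction_linear with
    | zero => rw [map_zero]; exact R.one_mem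
    | add x y hx hy =>
      have e : exp (inl Γ (x + y)) = exp (inl Γ x) * exp (inl Γ y) *
          exp (inr Γ (-(1 / 2 : ℚ) • bracketBilin Γ x y)) := by
        ext : 1
        ext : 1
        · simp only [log_mul, add_fst, smul_fst, bracket_fst, smul_zero, add_zero, inl_fst, inr_fst]
        · simp only [log_mul, add_fst, smul_fst, add_snd, smul_snd, bracket_fst, bracket_snd,
            smul_zero, add_zero, zero_add, inl_fst, inr_fst, inl_snd, inr_snd, map_zero]
          module
      rw [e]
      exact R.mul_mem (R.mul_mem hx hy) (hr _)
    | single v q =>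
      have e : inl Γ (Finsupp.single v q) = q • GraphLieAlgebra.ofVertex Γ v := by
        ext : 1 <;> simp
      rw [e]
      exact hR q v
  rw [eq_top_iff]
  rintro ⟨x⟩ -
  have e : exp x = exp (inl Γ x.1) * exp (inr Γ x.2) := by
    ext : 1
    ext : 1 <;> simp
  rw [e]
  exact R.mul_mem (hl _) (hr _)

end GraphMalcevGroup

end

end SimpleGraph

/-! ### The embedding of `N_Γ` in `G_Γ^ℚ`. -/

namespace SimpleGraph

variable {V : Type u}

noncomputable section

namespace GraphMalcevGroup

open GraphLieAlgebra

variable (Γ : SimpleGraph V)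

/-- The homomorphism `e^(w + u) ↦ w`. -/
def logFst : GraphMalcevGroup Γ →* Multiplicative (V →₀ ℚ) where
  toFun g := Multiplicative.ofAdd g.log.1
  map_one' := rfl
  map_mul' g h := by
    rw [log_mul, add_fst, smul_fst, bracket_fst, smul_zero, add_zero, add_fst, ofAdd_add]

theorem commute_ofVertex {v w : V} (h : Γ.Adj v w) : Commute (ofVertex Γ v) (ofVertex Γ w) := by
  rw [commute_iff]
  simp [ofVertex, bracketBilin_single, vertexBracket, h]

end GraphMalcevGroup

namespace TwoStepQuotient

open GraphMalcevGroup

variable (Γ : SimpleGraph V)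

/-- The homomorphism `N_Γ → G_Γ^ℚ` with `v ↦ e^v`. -/
def toMalcev : Γ.TwoStepQuotient →* Γ.GraphMalcevGroup :=
  lift (GraphMalcevGroup.isClassTwo Γ) (ofVertex Γ) fun _ _ => commute_ofVertex Γ

@[simp] theorem toMalcev_of (v : V) : toMalcev Γ (of Γ v) = ofVertex Γ v :=
  lift_of _ _ _ v

/-- `v ↦ v` from the free abelian group on the vertices to the abelianization of `N_Γ`. -/
def toAbelianization : (V →₀ ℤ) →+ Additive (Abelianization Γ.TwoStepQuotient) :=
  Finsupp.liftAddHom fun v => zmultiplesHom _ (Additive.ofMul (Abelianization.of (of Γ v)))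

theorem exists_toAbelianization_eq (n : Γ.TwoStepQuotient) :
    ∃ z, toAbelianization Γ z = Additive.ofMul (Abelianization.of n) := by
  have hn : n ∈ Subgroup.closure (Set.range (of Γ)) :=
    closure_range_of Γ ▸ Subgroup.mem_top n
  induction hn using Subgroup.closure_induction with
  | mem x hx =>
    obtain ⟨v, rfl⟩ := hx
    exact ⟨Finsupp.single v 1, by simp [toAbelianization]⟩
  | one => exact ⟨0, by simp⟩
  | mul x y _ _ hx hy =>
    obtain ⟨a, ha⟩ := hx
    obtain ⟨b, hb⟩ := hy
    exact ⟨a + b, by rw [map_add, ha, hb, map_mul, ofMul_mul]⟩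
  | inv x _ hx =>
    obtain ⟨a, ha⟩ := hx
    exact ⟨-a, by rw [map_neg, ha, map_inv, ofMul_inv]⟩

/-- The composite from integer vectors through the abelianization to `W` is the coordinatewise
inclusion of `ℤ` in `ℚ`. It is injective, so an integer vector representing the class of `n` must be
zero. -/
theorem mem_commutator_of_toMalcev_eq_one {n : Γ.TwoStepQuotient} (hn : toMalcev Γ n = 1) :
    n ∈ commutator Γ.TwoStepQuotient := by
  let D : Additive (Abelianization Γ.TwoStepQuotient) →+ (V →₀ ℚ) :=
    MonoidHom.toAdditiveLeft (Abelianization.lift ((logFst Γ).comp (toMalcev Γ)))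
  have hDB : D.comp (toAbelianization Γ) = Finsupp.mapRange.addMonoidHom (Int.castAddHom ℚ) := by
    ext v : 2
    simp [D, toAbelianization]
    rfl
  obtain ⟨z, hz⟩ := exists_toAbelianization_eq Γ n
  have h0 : D (Additive.ofMul (Abelianization.of n)) = 0 := by
    have : (logFst Γ) (toMalcev Γ n) = 1 := by rw [hn, map_one]
    simpa [D] using this
  rw [← hz] at h0
  have h1 : Finsupp.mapRange.addMonoidHom (Int.castAddHom ℚ) z = 0 := by rw [← hDB]; exact h0
  have hz0 : z = 0 := by
    ext v
    simpa using DFunLike.congr_fun h1 v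
  rw [hz0, map_zero] at hz
  rw [← Abelianization.ker_of]
  exact hz.symm

section Order

open scoped IsMulCommutative

variable [LinearOrder V]

/-- The pairs of non-adjacent vertices, each represented once. -/
abbrev NonadjacentPair : Type u := {p : V × V // p.1 < p.2 ∧ ¬ Γ.Adj p.1 p.2}

/-- The commutator of two vertices as a central element of `N_Γ`. -/
def centralCommutator (v w : V) : Subgroup.center Γ.TwoStepQuotient :=
  ⟨⁅of Γ v, of Γ w⁆, Subgroup.mem_center_iff.mpr fun z =>
    (TwoStepQuotient.isClassTwo Γ _ _ z).eq.symm⟩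

/-- `(v, w) ↦ ⁅v, w⁆` from the free abelian group on the non-adjacent pairs to the center
of `N_Γ`. -/
def commutatorHom :
    (NonadjacentPair Γ →₀ ℤ) →+ Additive (Subgroup.center Γ.TwoStepQuotient) :=
  Finsupp.liftAddHom fun p => zmultiplesHom _ (Additive.ofMul (centralCommutator Γ p.1.1 p.1.2))

/-- The subgroup of `N_Γ` generated by the commutators of non-adjacent pairs. -/
def commutatorRange : Subgroup Γ.TwoStepQuotient :=
  ((AddMonoidHom.toMultiplicativeLeft (commutatorHom Γ)).range).map
    (Subgroup.center Γ.TwoStepQuotient).subtype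

theorem mem_commutatorRange {n : Γ.TwoStepQuotient} :
    n ∈ commutatorRange Γ ↔ ∃ z, ((commutatorHom Γ z).toMul : Γ.TwoStepQuotient) = n := by
  constructor
  · rintro ⟨_, ⟨z, rfl⟩, rfl⟩
    exact ⟨z.toAdd, rfl⟩
  · rintro ⟨z, rfl⟩
    exact ⟨_, ⟨Multiplicative.ofAdd z, rfl⟩, rfl⟩

theorem commutator_le_commutatorRange :
    commutator Γ.TwoStepQuotient ≤ commutatorRange Γ := by
  have hle : commutatorRange Γ ≤ Subgroup.center Γ.TwoStepQuotient := by
    rintro _ ⟨z, -, rfl⟩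
    exact z.2
  have : (commutatorRange Γ).Normal := ⟨fun n hn g => by
    rw [Subgroup.mem_center_iff.mp (hle hn) g, mul_inv_cancel_right]
    exact hn⟩
  have hlt : ∀ v w, v < w → ⁅of Γ v, of Γ w⁆ ∈ commutatorRange Γ := by
    intro v w hvw
    by_cases h : Γ.Adj v w
    · rw [commutatorElement_eq_one_iff_commute.mpr (commute_of h)]
      exact one_mem _
    · refine (mem_commutatorRange Γ).mpr ⟨Finsupp.single ⟨(v, w), hvw, h⟩ 1, ?_⟩
      simp [commutatorHom, centralCommutator]
  refine commutator_le_of_closure_eq_top (closure_range_of Γ) _ ?_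
  rintro _ ⟨v, rfl⟩ _ ⟨w, rfl⟩
  rcases lt_trichotomy v w with h | rfl | h
  · exact hlt v w h
  · rw [commutatorElement_self]
    exact one_mem _
  · rw [← commutatorElement_inv]
    exact inv_mem (hlt w v h)

/-- The logarithm on the image of the center of `N_Γ`. -/
def centerLog : Additive (Subgroup.center Γ.TwoStepQuotient) →+ GraphLieAlgebra Γ where
  toFun n := (toMalcev Γ n.toMul).log
  map_zero' := by simp
  map_add' m n := by
    rw [toMul_add, Subgroup.coe_mul, map_mul]
    refine log_mul_of_commute (Commute.map ?_ (toMalcev Γ))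
    exact (Subgroup.mem_center_iff.mp m.toMul.2 n.toMul).symm

/-- The exponents of a product of commutators can be read off from its logarithm, so the commutators
of non-adjacent pairs are independent. -/
theorem wedgeCoeff_centerLog_commutatorHom (p : NonadjacentPair Γ)
    (z : NonadjacentPair Γ →₀ ℤ) :
    wedgeCoeff p.1.1 p.1.2 (centerLog Γ (commutatorHom Γ z)).2 = z p := by
  induction z using Finsupp.induction_linear with
  | zero => simp
  | add x y hx hy => simp [hx, hy]
  | single q k =>
    have h1 : centerLog Γ (commutatorHom Γ (Finsupp.single q k)) =
        (k : ℚ) • ⁅GraphLieAlgebra.ofVertex Γ q.1.1, GraphLieAlgebra.ofVertex Γ q.1.2⁆ := by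
      simp only [commutatorHom, Finsupp.liftAddHom_apply_single, zmultiplesHom_apply, map_zsmul]
      rw [Int.cast_smul_eq_zsmul]
      congr 1
      simp only [centerLog, centralCommutator, AddMonoidHom.coe_mk, ZeroHom.coe_mk, toMul_ofMul,
        map_commutatorElement, toMalcev_of, log_commutatorElement]
      rfl
    rw [h1, GraphLieAlgebra.smul_snd, Submodule.coe_smul, map_smul, GraphLieAlgebra.bracket_snd,
      wedgeCoeff_bracketBilin p.2.2]
    simp only [GraphLieAlgebra.ofVertex_fst]
    obtain ⟨⟨a, b⟩, hab, hp⟩ := p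
    obtain ⟨⟨c, d⟩, hcd, hq⟩ := q
    have h2 : ¬ (c = b ∧ d = a) := by
      rintro ⟨rfl, rfl⟩
      exact lt_asymm hab hcd
    simp only [Finsupp.single_apply, Subtype.mk.injEq, Prod.mk.injEq, smul_eq_mul]
    split_ifs <;> simp_all

end Order

theorem toMalcev_injective : Function.Injective (toMalcev Γ) := by
  classical
  -- Any linear order will do: it only selects one representative of each unordered pair.
  let _ : LinearOrder V := linearOrderOfSTO WellOrderingRel
  rw [injective_iff_map_eq_one]
  intro n hn
  obtain ⟨z, rfl⟩ := (mem_commutatorRange Γ).mp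
    (commutator_le_commutatorRange Γ (mem_commutator_of_toMalcev_eq_one Γ hn))
  have hz : z = 0 := by
    ext p
    have h := wedgeCoeff_centerLog_commutatorHom Γ p z
    have h0 : centerLog Γ (commutatorHom Γ z) = 0 := congrArg log hn
    rw [h0] at h
    simpa using h.symm
  rw [hz, map_zero]
  rfl

theorem isRationalCompletion_toMalcev : IsRationalCompletion (toMalcev Γ) where
  nilpotent := (GraphMalcevGroup.isClassTwo Γ).isNilpotent
  torsionFree := groupIsTorsionFree
  injective := toMalcev_injective Γ
  existsUnique_root _ _ hk := existsUnique_root _ hk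
  exists_pow_mem m := by
    have h : (GraphMalcevGroup.isClassTwo Γ).isolator (toMalcev Γ).range = ⊤ := by
      refine eq_top_of_exp_smul_ofVertex_mem fun q v => ?_
      -- Clearing the denominator of `q`: the power of `e^(qv)` with exponent `q.den` is the power
      -- of `e^v` with exponent `q.num`.
      refine ⟨q.den, q.den_pos, of Γ v ^ q.num, ?_⟩
      ext : 1
      rw [map_zpow, log_zpow, log_pow, smul_smul, Rat.den_mul_eq_num, toMalcev_of]
      rfl
    exact IsClassTwo.mem_isolator.mp (h ▸ Subgroup.mem_top m)

theorem groupIsTorsionFree : GroupIsTorsionFree Γ.TwoStepQuotient := fun n k hk h =>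
  toMalcev_injective Γ ((GraphMalcevGroup.groupIsTorsionFree _ k hk
    (by rw [← map_pow, h, map_one])).trans (map_one _).symm)

end TwoStepQuotient

end

end SimpleGraph

/-! ### Joins, products and commuting subsets of `W`. -/

namespace SimpleGraph

variable {V : Type u}

noncomputable section

namespace TwoStepQuotient

/-- If `Γ` is the simplicial join of `Γ₁` and `Γ₂`, then `N_Γ` is the product of `N_Γ₁` and
`N_Γ₂`. -/
def prodEquivOfJoin {V₁ V₂ : Type u} {Γ : SimpleGraph V} {Γ₁ : SimpleGraph V₁}
    {Γ₂ : SimpleGraph V₂} (f : Γ ≃g Γ₁.simplicialJoin Γ₂) :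
    Γ.TwoStepQuotient ≃* Γ₁.TwoStepQuotient × Γ₂.TwoStepQuotient :=
  let toProd : Γ.TwoStepQuotient →* Γ₁.TwoStepQuotient × Γ₂.TwoStepQuotient :=
    lift ((isClassTwo Γ₁).prod (isClassTwo Γ₂))
      (fun v => Sum.elim (fun a => (of Γ₁ a, 1)) (fun b => (1, of Γ₂ b)) (f v))
      (by
        intro v w h
        have h' := f.map_adj_iff.mpr h
        rcases hv : f v with a | a <;> rcases hw : f w with b | b <;> rw [hv, hw] at h'
        · exact Prod.ext (commute_of (Γ := Γ₁) h') rfl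
        · exact MonoidHom.commute_inl_inr _ _
        · exact (MonoidHom.commute_inl_inr _ _).symm
        · exact Prod.ext rfl (commute_of (Γ := Γ₂) h'))
  let ofFst : Γ₁.TwoStepQuotient →* Γ.TwoStepQuotient :=
    lift (isClassTwo Γ) (fun a => of Γ (f.symm (Sum.inl a))) fun a b (h : Γ₁.Adj a b) =>
      commute_of (f.symm.map_adj_iff.mpr (show (Γ₁.simplicialJoin Γ₂).Adj (.inl a) (.inl b) from h))
  let ofSnd : Γ₂.TwoStepQuotient →* Γ.TwoStepQuotient :=
    lift (isClassTwo Γ) (fun a => of Γ (f.symm (Sum.inr a))) fun a b (h : Γ₂.Adj a b) =>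
      commute_of (f.symm.map_adj_iff.mpr (show (Γ₁.simplicialJoin Γ₂).Adj (.inr a) (.inr b) from h))
  have hcomm : ∀ x y, Commute (ofFst x) (ofSnd y) := by
    intro x y
    have hx : x ∈ Subgroup.closure (Set.range (of Γ₁)) :=
      closure_range_of Γ₁ ▸ Subgroup.mem_top x
    have hy : y ∈ Subgroup.closure (Set.range (of Γ₂)) :=
      closure_range_of Γ₂ ▸ Subgroup.mem_top y
    induction hx using Subgroup.closure_induction with
    | mem x hx =>
      obtain ⟨a, rfl⟩ := hx
      induction hy using Subgroup.closure_induction with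
      | mem y hy =>
        obtain ⟨b, rfl⟩ := hy
        simp only [ofFst, ofSnd, lift_of]
        exact commute_of (f.symm.map_adj_iff.mpr
          (show (Γ₁.simplicialJoin Γ₂).Adj (.inl a) (.inr b) from trivial))
      | one => rw [map_one]; exact Commute.one_right _
      | mul y z _ _ hy hz => rw [map_mul]; exact hy.mul_right hz
      | inv y _ hy => rw [map_inv]; exact hy.inv_right
    | one => rw [map_one]; exact Commute.one_left _
    | mul x z _ _ hx hz => rw [map_mul]; exact hx.mul_left hz
    | inv x _ hx => rw [map_inv]; exact hx.inv_left
  have toProd_of : ∀ v, toProd (of Γ v) =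
      Sum.elim (fun a => (of Γ₁ a, 1)) (fun b => (1, of Γ₂ b)) (f v) := lift_of _ _ _
  have ofFst_of : ∀ a, ofFst (of Γ₁ a) = of Γ (f.symm (Sum.inl a)) := lift_of _ _ _
  have ofSnd_of : ∀ a, ofSnd (of Γ₂ a) = of Γ (f.symm (Sum.inr a)) := lift_of _ _ _
  MonoidHom.toMulEquiv toProd (MonoidHom.noncommCoprod ofFst ofSnd hcomm)
    (by
      refine hom_ext fun v => ?_
      change ofFst (toProd (of Γ v)).1 * ofSnd (toProd (of Γ v)).2 = of Γ v
      rw [toProd_of]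
      rcases hv : f v with a | a
      all_goals have hv' := (f.symm_apply_eq).mpr hv.symm
      · exact (congrArg₂ _ (ofFst_of a) (map_one ofSnd)).trans
          ((mul_one _).trans (congrArg (of Γ) hv'))
      · exact (congrArg₂ _ (map_one ofFst) (ofSnd_of a)).trans
          ((one_mul _).trans (congrArg (of Γ) hv')))
    (by
      have h₁ : toProd.comp ofFst = MonoidHom.inl _ _ := hom_ext fun a => by
        change toProd (ofFst (of Γ₁ a)) = _
        rw [ofFst_of, toProd_of, f.apply_symm_apply]
        rfl
      have h₂ : toProd.comp ofSnd = MonoidHom.inr _ _ := hom_ext fun a => by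
        change toProd (ofSnd (of Γ₂ a)) = _
        rw [ofSnd_of, toProd_of, f.apply_symm_apply]
        rfl
      rw [MonoidHom.comp_noncommCoprod]
      simp only [h₁, h₂]
      exact MonoidHom.noncommCoprod_inl_inr)

end TwoStepQuotient

theorem splitsAsSimplicialJoin_of_forall_adj {Γ : SimpleGraph V} (A : Set V) (hA : A.Nonempty)
    (hA' : Aᶜ.Nonempty) (h : ∀ a ∈ A, ∀ b ∈ Aᶜ, Γ.Adj a b) : Γ.SplitsAsSimplicialJoin := by
  classical
  refine ⟨A, ↥(Aᶜ), Γ.induce A, Γ.induce Aᶜ, hA.to_subtype, hA'.to_subtype, ⟨RelIso.symm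
    ⟨Equiv.Set.sumCompl A, ?_⟩⟩⟩
  rintro (a | a) (b | b)
  · exact Iff.rfl
  · exact iff_of_true (h a a.2 b b.2) trivial
  · exact iff_of_true (h b b.2 a a.2).symm trivial
  · exact Iff.rfl

/-- Two commuting subsets of the Lie algebra whose sums exhaust `W` and that are not contained
in `U` come from a splitting of the graph, unless there is only one vertex. -/
theorem splitsAsSimplicialJoin_of_bracketBilin_eq_zero {Γ : SimpleGraph V}
    {X Y : Set (V →₀ ℚ)} (hXY : ∀ x ∈ X, ∀ y ∈ Y, bracketBilin Γ x y = 0)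
    (hW : ∀ w, ∃ x ∈ X, ∃ y ∈ Y, w = x + y) (hX : ∃ x ∈ X, x ≠ 0) (hY : ∃ y ∈ Y, y ≠ 0)
    (hV : Nontrivial V) : Γ.SplitsAsSimplicialJoin := by
  classical
  -- The heart of the converse. If `a`, `b` were not adjacent, the vanishing minors would make every
  -- `x` in `X` and every `y` in `Y` satisfy the same relation, with coefficients from `x₀`. It then
  -- holds on all of `W`, but fails at the basis vector of `b`.
  have key : ∀ a b, a ≠ b → ∀ x₀ ∈ X, x₀ a ≠ 0 → ∀ y₀ ∈ Y, y₀ b ≠ 0 → Γ.Adj a b := by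
    intro a b hab x₀ hx₀ hxa y₀ hy₀ hyb
    by_contra hadj
    have hrel : ∀ x ∈ X, ∀ y ∈ Y, x a * y b = x b * y a := by
      intro x hx y hy
      have h := wedgeCoeff_bracketBilin hadj x y
      rw [hXY x hx y hy, Submodule.coe_zero, map_zero] at h
      exact (sub_eq_zero.mp h.symm)
    have hX' : ∀ x ∈ X, x b * x₀ a = x₀ b * x a := by
      intro x hx
      have h1 := hrel x hx y₀ hy₀
      have h2 := hrel x₀ hx₀ y₀ hy₀
      have hya : y₀ a ≠ 0 := by
        intro h
        rw [h, mul_zero] at h2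
        exact mul_ne_zero hxa hyb h2
      refine mul_right_cancel₀ (mul_ne_zero hya hyb) ?_
      linear_combination (-x₀ a * y₀ b) * h1 + (x a * y₀ b) * h2
    have hY' : ∀ y ∈ Y, y b * x₀ a = x₀ b * y a := by
      intro y hy
      linear_combination hrel x₀ hx₀ y hy
    have hall : ∀ w : V →₀ ℚ, w b * x₀ a = x₀ b * w a := by
      intro w
      obtain ⟨x, hx, y, hy, rfl⟩ := hW w
      rw [Finsupp.add_apply, Finsupp.add_apply]
      linear_combination hX' x hx + hY' y hy
    have h := hall (Finsupp.single b 1)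
    rw [Finsupp.single_eq_same, Finsupp.single_eq_of_ne hab, one_mul, mul_zero] at h
    exact hxa h
  have hne : ∀ a, (∀ y ∈ Y, y a = 0) → ∃ x ∈ X, x a ≠ 0 := by
    intro a ha
    obtain ⟨x, hx, y, hy, h⟩ := hW (Finsupp.single a 1)
    refine ⟨x, hx, fun h0 => ?_⟩
    have h1 := DFunLike.congr_fun h a
    rw [Finsupp.single_eq_same, Finsupp.add_apply, h0, ha y hy, add_zero] at h1
    exact one_ne_zero h1
  have hne' : ∀ a, (∀ x ∈ X, x a = 0) → ∃ y ∈ Y, y a ≠ 0 := by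
    intro a ha
    by_contra! h
    obtain ⟨x, hx, hxa⟩ := hne a h
    exact hxa (ha x hx)
  obtain ⟨x₁, hx₁, hx₁0⟩ := hX
  obtain ⟨y₁, hy₁, hy₁0⟩ := hY
  obtain ⟨a₁, ha₁⟩ := Finsupp.ne_iff.mp hx₁0
  obtain ⟨b₁, hb₁⟩ := Finsupp.ne_iff.mp hy₁0
  -- Every vertex is in the support of `X` or of `Y`. A vertex `c` in both is adjacent to all others
  -- and splits off as a cone point; if there is none, the two supports partition the vertices.
  by_cases hmix : ∃ c, (∃ x ∈ X, x c ≠ 0) ∧ (∃ y ∈ Y, y c ≠ 0)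
  · obtain ⟨c, ⟨x, hx, hxc⟩, ⟨y, hy, hyc⟩⟩ := hmix
    obtain ⟨d, hd⟩ := exists_ne c
    refine splitsAsSimplicialJoin_of_forall_adj {c} ⟨c, rfl⟩ ⟨d, hd⟩ ?_
    rintro _ rfl b (hb : b ≠ _)
    by_cases hbY : ∀ y ∈ Y, y b = 0
    · obtain ⟨x', hx', hxb⟩ := hne b hbY
      exact (key b _ hb x' hx' hxb y hy hyc).symm
    · push Not at hbY
      obtain ⟨y', hy', hyb⟩ := hbY
      exact key _ b hb.symm x hx hxc y' hy' hyb
  · push Not at hmix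
    refine splitsAsSimplicialJoin_of_forall_adj {a | ∃ x ∈ X, x a ≠ 0} ⟨a₁, x₁, hx₁, ha₁⟩
      ⟨b₁, fun ⟨x, hx, h⟩ => hb₁ (hmix b₁ ⟨x, hx, h⟩ y₁ hy₁)⟩ ?_
    rintro a ⟨x, hx, hxa⟩ b hb
    obtain ⟨y, hy, hyb⟩ := hne' b fun x hx => by
      by_contra h
      exact hb ⟨x, hx, h⟩
    refine key a b ?_ x hx hxa y hy hyb
    rintro rfl
    exact hb ⟨x, hx, hxa⟩

/-! ### Direct factors of `G_Γ^ℚ`. -/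

namespace GraphMalcevGroup

open GraphLieAlgebra

variable {Γ : SimpleGraph V}

/-- A direct factor of `G_Γ^ℚ` contained in `e^U` is trivial. -/
theorem subsingleton_of_log_fst_eq_zero {H : Type*} [Group H] (p : GraphMalcevGroup Γ →* H)
    (i : H →* GraphMalcevGroup Γ) (hpi : ∀ h, p (i h) = h) (h0 : ∀ h, (i h).log.1 = 0) :
    Subsingleton H := by
  have hi : Function.Injective i := Function.LeftInverse.injective hpi
  have hcomm : ∀ a b : H, Commute a b := fun a b =>
    (commute_iff.mpr (by rw [h0 a, map_zero, LinearMap.zero_apply])).of_map hi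
  -- Since `H` is abelian, `p` kills commutators and hence all of `e^U`, which contains the image of
  -- `i`; yet `p` is a left inverse of `i`.
  have hker : commutator (GraphMalcevGroup Γ) ≤ p.ker := by
    rw [commutator_def, Subgroup.commutator_le]
    intro x _ y _
    rw [MonoidHom.mem_ker, map_commutatorElement, commutatorElement_eq_one_iff_commute]
    exact hcomm _ _
  refine subsingleton_of_forall_eq 1 fun h => ?_
  have e : i h = exp (inr Γ (i h).log.2) := by
    ext : 1
    exact GraphLieAlgebra.ext (h0 h) rfl
  rw [← hpi h, e]
  exact hker (exp_inr_mem_commutator _)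

/-- The factors commute, so their projections to `W` have zero bracket and logarithms add; neither
projection is zero, because a factor inside `e^U` is trivial. -/
theorem directlyIndecomposable (hΓ : ¬ Γ.SplitsAsSimplicialJoin) :
    DirectlyIndecomposable (GraphMalcevGroup Γ) := by
  intro H K _ _ ⟨e⟩
  by_contra! hHK
  obtain ⟨hH, hK⟩ := hHK
  let i : H →* GraphMalcevGroup Γ := e.symm.toMonoidHom.comp (MonoidHom.inl H K)
  let j : K →* GraphMalcevGroup Γ := e.symm.toMonoidHom.comp (MonoidHom.inr H K)
  have hX : ∃ x ∈ Set.range (fun h => (i h).log.1), x ≠ 0 := by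
    by_contra! h0
    exact not_subsingleton H (subsingleton_of_log_fst_eq_zero
      ((MonoidHom.fst H K).comp e.toMonoidHom) i (fun h => by simp [i]) fun h => h0 _ ⟨h, rfl⟩)
  have hY : ∃ y ∈ Set.range (fun k => (j k).log.1), y ≠ 0 := by
    by_contra! h0
    exact not_subsingleton K (subsingleton_of_log_fst_eq_zero
      ((MonoidHom.snd H K).comp e.toMonoidHom) j (fun h => by simp [j]) fun h => h0 _ ⟨h, rfl⟩)
  have hcomm : ∀ h k, Commute (i h) (j k) := fun h k =>
    (MonoidHom.commute_inl_inr h k).map e.symm.toMonoidHom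
  have hW : ∀ w, ∃ x ∈ Set.range (fun h => (i h).log.1),
      ∃ y ∈ Set.range (fun k => (j k).log.1), w = x + y := by
    intro w
    refine ⟨_, ⟨(e (exp (inl Γ w))).1, rfl⟩, _, ⟨(e (exp (inl Γ w))).2, rfl⟩, ?_⟩
    have h1 : i (e (exp (inl Γ w))).1 * j (e (exp (inl Γ w))).2 = exp (inl Γ w) := by
      simp only [i, j, MonoidHom.comp_apply, ← map_mul]
      simp
    have h2 := log_mul_of_commute (hcomm (e (exp (inl Γ w))).1 (e (exp (inl Γ w))).2)
    rw [h1] at h2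
    exact congrArg (fun x : GraphLieAlgebra Γ => x.1) h2
  refine hΓ (splitsAsSimplicialJoin_of_bracketBilin_eq_zero ?_ hW hX hY ?_)
  · rintro _ ⟨h, rfl⟩ _ ⟨k, rfl⟩
    exact commute_iff.mp (hcomm h k)
  · obtain ⟨_, ⟨h, rfl⟩, hx⟩ := hX
    obtain ⟨_, ⟨k, rfl⟩, hy⟩ := hY
    obtain ⟨c, hc⟩ := Finsupp.ne_iff.mp hx
    -- With one vertex `U = 0` and the group is a copy of `ℚ`. The ratio `r` of two nonzero
    -- logarithms gives a power of `i h` equal to a power of `j k` with nonzero exponent; as the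
    -- factors meet trivially, this forces `k` to have zero logarithm.
    by_contra hV
    rw [not_nontrivial_iff_subsingleton] at hV
    obtain ⟨d, hd⟩ := Finsupp.ne_iff.mp hy
    obtain rfl := Subsingleton.elim c d
    have hU : ∀ u : wedgeSubspace Γ, u = 0 := by
      have hle : wedgeSubspace Γ ≤ ⊥ := by
        refine Submodule.span_le.mpr ?_
        rintro _ ⟨v, w, -, rfl⟩
        have h := wedge_swap v w
        rw [Subsingleton.elim v w] at h ⊢
        have h2 : (2 : ℚ) • wedge w w = 0 := by
          rw [two_smul]
          exact eq_neg_iff_add_eq_zero.mp h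
        exact (smul_eq_zero.mp h2).resolve_left two_ne_zero
      exact fun u => Subtype.ext ((Submodule.mem_bot ℚ).mp (hle u.2))
    let r : ℚ := (i h).log.1 c / (j k).log.1 c
    have hr : r ≠ 0 := div_ne_zero hc hd
    have hpow : i (h ^ (r.den : ℤ)) = j (k ^ r.num) := by
      rw [map_zpow, map_zpow]
      ext : 1
      rw [log_zpow, log_zpow]
      refine GraphLieAlgebra.ext ?_ ((hU _).trans (hU _).symm)
      ext d
      obtain rfl := Subsingleton.elim c d
      have h1 : (r.num : ℚ) = r.den * r := (Rat.den_mul_eq_num r).symm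
      have h2 : r * (j k).log.1 c = (i h).log.1 c := div_mul_cancel₀ _ hd
      simp only [smul_fst, Finsupp.smul_apply, smul_eq_mul, h1, ← h2, Int.cast_natCast]
      ring
    have hpair := e.symm.injective hpow
    have hk : k ^ r.num = 1 := (congrArg Prod.snd hpair).symm
    have h3 : (r.num : ℚ) • (j k).log = 0 := by
      rw [← log_zpow, ← map_zpow, hk, map_one, log_one]
    have h4 := (smul_eq_zero.mp h3).resolve_left (Int.cast_ne_zero.mpr (Rat.num_ne_zero.mpr hr))
    exact hy (congrArg (fun x : GraphLieAlgebra Γ => x.1) h4)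

theorem nontrivial [Nonempty V] : Nontrivial (GraphMalcevGroup Γ) := by
  obtain ⟨v⟩ := ‹Nonempty V›
  refine ⟨ofVertex Γ v, 1, fun h => ?_⟩
  have h1 : Finsupp.single v (1 : ℚ) = 0 := congrArg (fun g => g.log.1) h
  exact one_ne_zero (Finsupp.single_eq_zero.mp h1)

end GraphMalcevGroup

end

end SimpleGraph

open SimpleGraph in
theorem rationallyIndecomposable_twoStepQuotient_iff {V : Type u} (Γ : SimpleGraph V) :
    RationallyIndecomposable Γ.TwoStepQuotient ↔ ¬ Γ.SplitsAsSimplicialJoin := by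
  constructor
  · rintro ⟨M, _, φ, hφ, hM⟩ ⟨V₁, V₂, Γ₁, Γ₂, _, _, ⟨f⟩⟩
    -- The product of the two completions is a completion of `N_Γ`, so uniqueness transfers its
    -- factorization to the given `M`.
    have hψ := ((TwoStepQuotient.isRationalCompletion_toMalcev Γ₁).prodMap
      (TwoStepQuotient.isRationalCompletion_toMalcev Γ₂)).comp_mulEquiv
        (TwoStepQuotient.prodEquivOfJoin f)
    obtain ⟨e, -⟩ := hφ.exists_mulEquiv hψ (TwoStepQuotient.isClassTwo Γ)
    have h₁ : Nontrivial Γ₁.GraphMalcevGroup := GraphMalcevGroup.nontrivial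
    have h₂ : Nontrivial Γ₂.GraphMalcevGroup := GraphMalcevGroup.nontrivial
    rcases hM _ _ ⟨e⟩ with h | h
    · exact not_subsingleton _ h
    · exact not_subsingleton _ h
  · exact fun h => ⟨_, _, _, TwoStepQuotient.isRationalCompletion_toMalcev Γ,
      GraphMalcevGroup.directlyIndecomposable h⟩

/-- For a finite simple graph `Γ`, the group `N_Γ` is finitely generated, torsion-free and nilpotent;
the assignment `v ↦ e^v` defines a homomorphism that makes `G_Γ^ℚ` the rational Malcev completion
of `N_Γ` (unique up to an isomorphism compatible with the embeddings of `N_Γ`); and `N_Γ` is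
rationally indecomposable if and only if `Γ` does not split as a simplicial join. -/
theorem mainTheorem8 {V : Type u} [Finite V] (Γ : SimpleGraph V) :
    (Group.FG Γ.TwoStepQuotient ∧ GroupIsTorsionFree Γ.TwoStepQuotient ∧
      Group.IsNilpotent Γ.TwoStepQuotient) ∧
    (∃ F : Γ.TwoStepQuotient →* Γ.GraphMalcevGroup,
      (∀ v : V, F (SimpleGraph.TwoStepQuotient.of Γ v) =
        SimpleGraph.GraphMalcevGroup.ofVertex Γ v) ∧
      IsRationalCompletion F ∧
      ∀ (M : Type u) [Group M] (φ : Γ.TwoStepQuotient →* M), IsRationalCompletion φ →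
        ∃ e : Γ.GraphMalcevGroup ≃* M, e.toMonoidHom.comp F = φ) ∧
    (RationallyIndecomposable Γ.TwoStepQuotient ↔ ¬ Γ.SplitsAsSimplicialJoin) := by

  exact ⟨⟨SimpleGraph.TwoStepQuotient.fg Γ, SimpleGraph.TwoStepQuotient.groupIsTorsionFree Γ,
      (SimpleGraph.TwoStepQuotient.isClassTwo Γ).isNilpotent⟩,
    ⟨SimpleGraph.TwoStepQuotient.toMalcev Γ, SimpleGraph.TwoStepQuotient.toMalcev_of Γ,
      SimpleGraph.TwoStepQuotient.isRationalCompletion_toMalcev Γ, fun _ _ _ hφ =>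
        (SimpleGraph.TwoStepQuotient.isRationalCompletion_toMalcev Γ).exists_mulEquiv hφ
          (SimpleGraph.TwoStepQuotient.isClassTwo Γ)⟩,
    rationallyIndecomposable_twoStepQuotient_iff Γ⟩
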